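/- Let $N\ge 2$, $a\in\mathbb R$, and let $I,J\subseteq\mathbb R$ be open intervals. All functions are real-valued and $C^\infty$ on the indicated domains; $t\in I$, $x\in J$. Consider the finite lattice $$\partial^2_{tx}v_n=\partial_t v_n\,\partial_x v_n\left(\frac1{v_n-v_{n-1}}-\frac1{v_{n+1}-v_n}\right),\qquad 1\le n\le N-1,\qquad v_0=v_N=a, \tag{1}$$ for $v_1,\dots,v_{N-1}$ on $I\times J$, where it is understood that $v_n\ne v_{n+1}$ everywhere for $0\le n\le N-1$. Call a solution generic if $\partial_t v_n$ and $\partial_x v_n$ vanish nowhere for $1\le n\le N-2$. For functions $X_0,\dots,X_{N-2}$ of $x\in J$ and $T_0,\dots,T_{N-2}$ of $t\in I$ put $$\alpha_{ij}=\sum_{s=1}^{N-2}X_s^{(i)}T_s^{(j)},\qquad \beta_{kl}=\delta_{k1}T_0^{(l-1)}+\delta_{1l}X_0^{(k-1)}+\sum_{s=1}^{N-2}X_s^{(k-1)}T_s^{(l-1)},$$ and consider $$v_n=\frac{\det(\alpha_{ij})_{i,j=1}^{n-1}}{\det(\beta_{kl})_{k,l=1}^{n}}+a,\qquad 1\le n\le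 N-1. \tag{2}$$ 1. For all $X_s,T_s$ one has $\det(\alpha_{ij})_{i,j=1}^{N-1}=0$ on $I\times J$ (so that (2) for $n=N$ is consistent with $v_N=a$). If $\det(\beta_{kl})_{k,l=1}^{n}$ vanishes nowhere on $I\times J$ for $1\le n\le N-1$, and if the functions (2) together with $v_0=v_N=a$ satisfy $v_n\neq v_{n+1}$ everywhere for $0\le n\le N-1$, then they form a generic solution of (1). 2. Conversely, for every generic solution of (1) on $I\times J$ there are functions $X_0,\dots,X_{N-2}$ and $T_0,\dots,T_{N-2}$ such that, for $1\le n\le N-1$, $\det(\beta_{kl})_{k,l=1}^n$ vanishes nowhere and (2) holds on $I\times J$. 3. For a function $f(t,x)$ let $w_n(f)=\det(\partial_x^{i}\partial_t^{j}f)_{i,j=0}^{n-1}$, $w_0(f)=1$. If $u=X_0(x)+T_0(t)+\sum_{s=1}^{N-2}X_s(x)T_s(t)$ on $I\times J$, then $w_{N-1}(u_{tx})=0$. Conversely, if $u$ satisfies $w_{N-1}(u_{tx})=0$ and $w_{N-2}(u_{tx})\ne0$ everywhere on $I\times J$, then $u$ is of this form. -/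

import Mathlib

open scoped ContDiff

namespace FSY

/-- Partial derivative in the first variable `t` of a function `u(t, x)`. -/
noncomputable def partialT (u : ℝ → ℝ → ℝ) : ℝ → ℝ → ℝ :=
  fun t x => deriv (fun τ => u τ x) t

/-- Partial derivative in the second variable `x` of a function `u(t, x)`. -/
noncomputable def partialX (u : ℝ → ℝ → ℝ) : ℝ → ℝ → ℝ :=
  fun t x => deriv (fun ξ => u t ξ) x

/-- `u` is a smooth function of `(t, x)` on the open rectangle `I × J`. -/
def SmoothOn₂ (I J : Set ℝ) (u : ℝ → ℝ → ℝ) : Prop :=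
  ContDiffOn ℝ ∞ (fun p : ℝ × ℝ => u p.1 p.2) (I ×ˢ J)

/-- The determinant `w_n(u)` of the `n × n` matrix with entries `∂_x^i ∂_t^j u`,
`0 ≤ i, j ≤ n - 1`; in particular `w_0(u) = 1`. -/
noncomputable def w (n : ℕ) (u : ℝ → ℝ → ℝ) (t x : ℝ) : ℝ :=
  Matrix.det (Matrix.of fun i j : Fin n => (partialX^[(i : ℕ)] (partialT^[(j : ℕ)] u)) t x)

/-- The lattice equation for `v_n` (`n ≥ 1`) at the point `(t, x)`. -/
def LatticeEq (v : ℕ → ℝ → ℝ → ℝ) (n : ℕ) (t x : ℝ) : Prop :=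
  partialX (partialT (v n)) t x =
    partialT (v n) t x * partialX (v n) t x *
      (1 / (v n t x - v (n - 1) t x) - 1 / (v (n + 1) t x - v n t x))

/-- `v_0, …, v_N` satisfy on `I × J` the boundary condition `v_0 = v_N = a`, and neighbouring
components never coincide, so that no denominator of the lattice equations vanishes. -/
structure Admissible (N : ℕ) (a : ℝ) (I J : Set ℝ) (v : ℕ → ℝ → ℝ → ℝ) : Prop where
  left : ∀ t ∈ I, ∀ x ∈ J, v 0 t x = a
  right : ∀ t ∈ I, ∀ x ∈ J, v N t x = a
  ne : ∀ n < N, ∀ t ∈ I, ∀ x ∈ J, v n t x ≠ v (n + 1) t x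

/-- `v_0, …, v_N` is a smooth solution on `I × J` of the finite lattice with boundary condition
`v_0 = v_N = a`. -/
structure IsSolution (N : ℕ) (a : ℝ) (I J : Set ℝ) (v : ℕ → ℝ → ℝ → ℝ) : Prop
    extends Admissible N a I J v where
  smooth : ∀ n ≤ N, SmoothOn₂ I J (v n)
  eqn : ∀ n, 1 ≤ n → n + 1 ≤ N → ∀ t ∈ I, ∀ x ∈ J, LatticeEq v n t x

/-- Genericity: `∂_t v_n` and `∂_x v_n` vanish nowhere on `I × J` for `1 ≤ n ≤ N - 2`. -/
def Generic (N : ℕ) (I J : Set ℝ) (v : ℕ → ℝ → ℝ → ℝ) : Prop :=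
  ∀ n, 1 ≤ n → n + 2 ≤ N → ∀ t ∈ I, ∀ x ∈ J,
    partialT (v n) t x ≠ 0 ∧ partialX (v n) t x ≠ 0

/-- The functions `T_0, …, T_{N-2}` are smooth on `I`, and `X_0, …, X_{N-2}` are smooth on `J`. -/
def SmoothData (N : ℕ) (I J : Set ℝ) (X T : ℕ → ℝ → ℝ) : Prop :=
  ∀ s, s + 2 ≤ N → ContDiffOn ℝ ∞ (T s) I ∧ ContDiffOn ℝ ∞ (X s) J

/-- The `(n-1) × (n-1)` matrix `α_{ij}`, `i, j = 1, …, n - 1` (indices of `Fin` start at `0`). -/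
noncomputable def alpha (N : ℕ) (X T : ℕ → ℝ → ℝ) (n : ℕ) (t x : ℝ) :
    Matrix (Fin (n - 1)) (Fin (n - 1)) ℝ :=
  Matrix.of fun i j =>
    ∑ s ∈ Finset.Icc 1 (N - 2),
      iteratedDeriv ((i : ℕ) + 1) (X s) x * iteratedDeriv ((j : ℕ) + 1) (T s) t

/-- The `n × n` matrix `β_{kl}`, `k, l = 1, …, n` (indices of `Fin` start at `0`). -/
noncomputable def beta (N : ℕ) (X T : ℕ → ℝ → ℝ) (n : ℕ) (t x : ℝ) :
    Matrix (Fin n) (Fin n) ℝ :=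
  Matrix.of fun k l =>
    (if (k : ℕ) = 0 then iteratedDeriv (l : ℕ) (T 0) t else 0) +
    (if (l : ℕ) = 0 then iteratedDeriv (k : ℕ) (X 0) x else 0) +
    ∑ s ∈ Finset.Icc 1 (N - 2), iteratedDeriv (k : ℕ) (X s) x * iteratedDeriv (l : ℕ) (T s) t

/-- On `I × J`, for `1 ≤ n ≤ N - 1`: `det β` of size `n` does not vanish and
`v_n = det α / det β + a`. -/
def IsGivenBy (N : ℕ) (a : ℝ) (I J : Set ℝ) (X T : ℕ → ℝ → ℝ) (v : ℕ → ℝ → ℝ → ℝ) : Prop :=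
  ∀ n, 1 ≤ n → n + 1 ≤ N → ∀ t ∈ I, ∀ x ∈ J,
    (beta N X T n t x).det ≠ 0 ∧
    v n t x = (alpha N X T n t x).det / (beta N X T n t x).det + a

/-- On `I × J`: `u = X_0(x) + T_0(t) + ∑_{s=1}^{N-2} X_s(x) T_s(t)`. -/
def IsSeparatedSum (N : ℕ) (I J : Set ℝ) (X T : ℕ → ℝ → ℝ) (u : ℝ → ℝ → ℝ) : Prop :=
  ∀ t ∈ I, ∀ x ∈ J, u t x = X 0 x + T 0 t + ∑ s ∈ Finset.Icc 1 (N - 2), X s x * T s t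

end FSY

/-!
Let `u = 1 / (v_1 - a)` and let `τ_n`, `σ_n`, `p_n`, `q_n` be the contiguous `n × n` minors of the
infinite array `∂_x^i ∂_t^j u` with initial indices `(0, 0)`, `(1, 1)`, `(1, 0)`, `(0, 1)`. Put
`v_n = a + σ_{n-1} / τ_n`. All these minors are Wronskians, so that Jacobi's identity gives
`∂_t v_{n+1} = -p_n q_{n+1} / τ_{n+1}^2` and its relatives, while the Plücker relation gives
`v_{n+1} - v_n = p_n q_n / (τ_n τ_{n+1})`. Once `v_{n-1}` and `v_n` are of this form, the lattice
equation at `n` becomes `(v_{n+1} - a) τ_{n+1} = σ_n`: the lattice expresses every `v_n` through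
`u`, and the boundary condition `v_N = a` turns into `σ_{N-1} = w_{N-1}(u_{tx}) = 0`. By Bôcher's
theorem (vanishing of the Wronskian of `f_1, …, f_n, g` forces `g` into the span of the `f_i`
where the Wronskian of the `f_i` vanishes nowhere), applied in `t` and then in `x`, `u_{tx}` is
then a sum of `N - 2` products of a function of `x` and a function of `t`. For such `u` the array
is `β`.
-/

namespace FSY

open Matrix

section Wronskian

variable {R : Type*} [CommRing R] {n : ℕ}

/-- The determinant of the first `n` terms of `n` sequences, as an alternating map. It is the
Wronskian of `n` functions when each sequence consists of the successive derivatives of one of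
them; in particular `Pi.single 0 1` stands for the constant function `1`. -/
def wronskian : (ℕ → R) [⋀^Fin n]→ₗ[R] R :=
  detRowAlternating.compLinearMap (LinearMap.funLeft R R Fin.val)

/-- The determinant `wronskian F` with the last column moved one term further along the
sequences. It is the derivative of the Wronskian when the sequences consist of successive
derivatives. -/
def wronskianDeriv (F : Fin (n + 1) → ℕ → R) : R :=
  (of fun i j : Fin (n + 1) => F i ((Fin.last n).castSucc.succAbove j)).det

theorem wronskian_apply (F : Fin n → ℕ → R) : wronskian F = (of fun i j : Fin n => F i j).det :=
  rfl

theorem wronskian_mul_apply (M : Fin n → ℕ → R) (c : ℕ → R) (j : Fin n) :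
    wronskian M * c j = ∑ i, wronskian (Function.update M i c) * M i j := by
  have wronskian_update (i) : wronskian (Function.update M i c) =
      (of fun i j : Fin n => M i j)ᵀ.cramer (fun j => c j) i := by
    rw [cramer_transpose_apply]
    exact congrArg detRowAlternating
      (Function.comp_update (LinearMap.funLeft R R Fin.val) M i c)
  have cramer := congrFun (mulVec_cramer (of fun i j : Fin n => M i j)ᵀ fun j => c j) j
  simp only [wronskian_update, mul_comm _ (M _ _)]
  simpa only [det_transpose] using! cramer.symm

theorem wronskian_mul_wronskian_vecCons (M : Fin (n + 1) → ℕ → R) (c : ℕ → R)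
    (G : Fin n → ℕ → R) :
    wronskian M * wronskian (vecCons c G) =
      ∑ i, wronskian (Function.update M i c) * wronskian (vecCons (M i) G) := by
  simp only [wronskian_apply (vecCons _ G), det_succ_row_zero, Finset.mul_sum]
  rw [Finset.sum_comm]
  refine Finset.sum_congr rfl fun j _ => ?_
  calc _ = wronskian M * c j * ((-1) ^ (j : ℕ) * (of fun i k => G i (j.succAbove k)).det) := by
        simp only [Nat.succ_eq_add_one, cons_val', of_apply, cons_val_zero, submatrix,
          cons_val_succ]
        ring
    _ = _ := by
        rw [wronskian_mul_apply, Finset.sum_mul]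
        refine Finset.sum_congr rfl fun i _ => ?_
        simp only [Nat.succ_eq_add_one, cons_val', of_apply, cons_val_zero, submatrix,
          cons_val_succ]
        ring

theorem wronskian_vecCons_single (k : Fin (n + 1)) (F : Fin n → ℕ → R) :
    wronskian (vecCons (Pi.single (k : ℕ) 1) F) =
      (-1) ^ (k : ℕ) * (of fun i j : Fin n => F i (k.succAbove j)).det := by
  rw [wronskian_apply, det_succ_row_zero, Finset.sum_eq_single k]
  · simp only [Nat.succ_eq_add_one, cons_val', of_apply, Pi.single_eq_same, cons_val_zero, mul_one]
    rfl
  · intro j _ hj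
    simp [Fin.val_inj, hj]
  · simp

theorem wronskian_vecCons_single_zero (F : Fin n → ℕ → R) :
    wronskian (vecCons (Pi.single 0 1) F) = wronskian fun i j => F i (j + 1) := by
  simpa [wronskian_apply] using wronskian_vecCons_single 0 F

theorem wronskian_vecCons_single_last (F : Fin n → ℕ → R) :
    wronskian (vecCons (Pi.single n 1) F) = (-1) ^ n * wronskian F := by
  simpa [wronskian_apply] using wronskian_vecCons_single (Fin.last n) F

theorem wronskian_vecCons_single_castSucc_last (F : Fin (n + 1) → ℕ → R) :
    wronskian (vecCons (Pi.single n 1) F) = (-1) ^ n * wronskianDeriv F := by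
  simpa [wronskianDeriv] using wronskian_vecCons_single (Fin.last n).castSucc F

theorem wronskian_vecCons_vecCons_mul (a b c d : ℕ → R) (F : Fin n → ℕ → R) :
    wronskian (vecCons a (vecCons b F)) * wronskian (vecCons c (vecCons d F)) =
      wronskian (vecCons c (vecCons b F)) * wronskian (vecCons a (vecCons d F)) +
        wronskian (vecCons a (vecCons c F)) * wronskian (vecCons b (vecCons d F)) := by
  have repeated (k : Fin n) : wronskian (vecCons (F k) (vecCons d F)) = 0 :=
    wronskian.map_eq_zero_of_eq _ (i := 0) (j := k.succ.succ) (by simp) (Fin.succ_ne_zero _).symm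
  rw [wronskian_mul_wronskian_vecCons, Fin.sum_univ_succ, Fin.sum_univ_succ]
  have update_one : Function.update (vecCons a (vecCons b F)) 1 c = vecCons a (vecCons c F) :=
    (Fin.cons_update (α := fun _ => ℕ → R) a (vecCons b F) 0 c).symm.trans <|
      congrArg (vecCons a) (Fin.update_cons_zero (α := fun _ => ℕ → R) b F c)
  have update_zero : Function.update (vecCons a (vecCons b F)) 0 c = vecCons c (vecCons b F) :=
    Fin.update_cons_zero _ _ _
  simp [repeated, update_one, update_zero]

-- The Plücker relation for the sequences extended by the unit vectors `e_{n+1}` and `e_n`, which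
-- turn a determinant of size `n + 2` into `wronskian` and `wronskianDeriv` of lower size.
theorem wronskian_vecCons_vecCons_mul_wronskian (a b : ℕ → R) (F : Fin n → ℕ → R) :
    wronskian (vecCons a (vecCons b F)) * wronskian F =
      wronskian (vecCons a F) * wronskianDeriv (vecCons b F) -
        wronskianDeriv (vecCons a F) * wronskian (vecCons b F) := by
  have h := wronskian_vecCons_vecCons_mul (Pi.single (n + 1) 1) a (Pi.single n 1) b F
  simp only [wronskian_vecCons_single_last, wronskian_vecCons_single_castSucc_last] at h
  have sign : (-1 : R) ^ n * (-1) ^ n = 1 := by simp [← mul_pow]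
  linear_combination h - (wronskian (vecCons a (vecCons b F)) * wronskian F -
    wronskian (vecCons a F) * wronskianDeriv (vecCons b F) +
      wronskianDeriv (vecCons a F) * wronskian (vecCons b F)) * sign

theorem wronskian_mul_wronskian_vecCons_vecCons (a b c : ℕ → R) (F : Fin n → ℕ → R) :
    wronskian (vecCons a F) * wronskian (vecCons b (vecCons c F)) =
      wronskian (vecCons b (vecCons a F)) * wronskian (vecCons c F) +
        wronskian (vecCons b F) * wronskian (vecCons a (vecCons c F)) := by
  have h := wronskian_vecCons_vecCons_mul (Pi.single (n + 1) 1) a b c F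
  simp only [wronskian_vecCons_single_last] at h
  rw [mul_left_comm (wronskian _), mul_assoc, mul_assoc, ← mul_add] at h
  exact (IsUnit.pow _ isUnit_neg_one).mul_left_cancel h

theorem wronskian_insertNth (p : Fin (n + 1)) (a : ℕ → R) (F : Fin n → ℕ → R) :
    wronskian (p.insertNth a F) = (-1) ^ (p : ℕ) * wronskian (vecCons a F) := by
  simpa [zsmul_eq_mul] using! wronskian.map_insertNth p a F

end Wronskian

section Minor

variable {R : Type*} [CommRing R] {n : ℕ}

/-- The `n × n` contiguous minor of the infinite array `A` whose first row and column have
indices `r` and `c`. -/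
def minor (A : ℕ → ℕ → R) (r c n : ℕ) : R :=
  (of fun i j : Fin n => A (i + r) (j + c)).det

@[simp]
theorem minor_zero (A : ℕ → ℕ → R) (r c : ℕ) : minor A r c 0 = 1 :=
  det_fin_zero

theorem minor_transpose (A : ℕ → ℕ → R) (r c n : ℕ) :
    minor (fun i j => A j i) r c n = minor A c r n :=
  det_transpose _

theorem vecCons_comp_val_succ {α : Type*} (F : ℕ → α) :
    vecCons (F 0) (fun i : Fin n => F (i + 1)) = fun i : Fin (n + 1) => F i := by
  funext i
  cases i using Fin.cases <;> rfl

theorem alternatingMap_comp_val {M : Type*} [AddCommGroup M] [Module R M]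
    (f : M [⋀^Fin (n + 1)]→ₗ[R] R) (F : ℕ → M) :
    (f fun i => F i) = (-1) ^ n * f (vecCons (F n) fun i : Fin n => F i) := by
  have snoc : (fun i : Fin (n + 1) => F i) =
      (Fin.last n).insertNth (α := fun _ => M) (F n) fun i : Fin n => F i := by
    rw [Fin.insertNth_last']
    exact (Fin.snoc_init_self fun i : Fin (n + 1) => F i).symm
  rw [snoc, f.map_insertNth]
  simp [zsmul_eq_mul]

theorem minor_col_one (A : ℕ → ℕ → R) (r : ℕ) :
    minor A r 1 n = wronskian (vecCons (Pi.single 0 1) fun i : Fin n => A (i + r)) :=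
  (wronskian_vecCons_single_zero _).symm

theorem minor_zero_zero (A : ℕ → ℕ → R) : minor A 0 0 n = wronskian fun i : Fin n => A i :=
  rfl

theorem minor_zero_zero_succ (A : ℕ → ℕ → R) :
    minor A 0 0 (n + 1) = wronskian (vecCons (A 0) fun i : Fin n => A (i + 1)) :=
  congrArg wronskian (vecCons_comp_val_succ A).symm

theorem minor_one_one_mul_sub (A : ℕ → ℕ → R) (n : ℕ) :
    minor A 1 1 (n + 1) * minor A 0 0 (n + 1) - minor A 1 1 n * minor A 0 0 (n + 2) =
      minor A 1 0 (n + 1) * minor A 0 1 (n + 1) := by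
  have plucker := wronskian_mul_wronskian_vecCons_vecCons (A 0) (Pi.single 0 1) (A (n + 1))
    fun i : Fin n => A (i + 1)
  rw [vecCons_comp_val_succ A] at plucker
  have move_last (b : ℕ → R) : wronskian (vecCons b fun i : Fin (n + 1) => A (i + 1)) =
      (-1) ^ n * wronskian (vecCons b (vecCons (A (n + 1)) fun i : Fin n => A (i + 1))) :=
    alternatingMap_comp_val (wronskian.curryLeft b) fun i => A (i + 1)
  have minor_row_one : minor A 1 0 (n + 1) =
      (-1) ^ n * wronskian (vecCons (A (n + 1)) fun i : Fin n => A (i + 1)) :=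
    alternatingMap_comp_val wronskian fun i => A (i + 1)
  rw [minor_zero_zero_succ (n := n + 1), minor_zero_zero, minor_row_one, minor_col_one,
    minor_col_one, minor_col_one, move_last, move_last]
  linear_combination (-1) ^ n * plucker

end Minor

section Calculus

variable {𝕜 : Type*} [NontriviallyNormedField 𝕜] {n : ℕ} {s : 𝕜}

theorem hasDerivAt_det {ι 𝔸 : Type*} [Fintype ι] [DecidableEq ι] [NormedCommRing 𝔸]
    [NormedAlgebra 𝕜 𝔸] {A : 𝕜 → Matrix ι ι 𝔸} {A' : Matrix ι ι 𝔸}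
    (h : ∀ i j, HasDerivAt (fun z => A z i j) (A' i j) s) :
    HasDerivAt (fun z => (A z).det) (∑ k, ((A s).updateCol k fun i => A' i k).det) s := by
  simp only [det_apply]
  have term (σ : Equiv.Perm ι) :=
    (HasDerivAt.fun_finsetProd (u := Finset.univ) fun i _ => h (σ i) i).const_smul
      (Equiv.Perm.sign σ)
  convert! HasDerivAt.fun_sum (u := Finset.univ) fun σ _ => term σ using 1
  rw [Finset.sum_comm]
  refine Finset.sum_congr rfl fun σ _ => ?_
  rw [Finset.smul_sum]
  refine Finset.sum_congr rfl fun k _ => ?_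
  rw [← Finset.prod_erase_mul _ _ (Finset.mem_univ k), updateCol_self, smul_eq_mul]
  congr 2
  exact Finset.prod_congr rfl fun j hj => updateCol_ne (Finset.ne_of_mem_erase hj)

/-- At the point `s`, each term of the sequence of functions `f` is the derivative of the
preceding one. -/
def DerivSeqAt (f : 𝕜 → ℕ → 𝕜) (s : 𝕜) : Prop :=
  ∀ j, HasDerivAt (fun z => f z j) (f s (j + 1)) s

theorem derivSeqAt_single_zero_one : DerivSeqAt (fun _ => Pi.single 0 1) s := fun j => by
  simpa using hasDerivAt_const s ((Pi.single 0 1 : ℕ → 𝕜) j)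

theorem hasDerivAt_wronskian {F : 𝕜 → Fin (n + 1) → ℕ → 𝕜}
    (hF : ∀ i, DerivSeqAt (fun z => F z i) s) :
    HasDerivAt (fun z => wronskian (F z)) (wronskianDeriv (F s)) s := by
  refine (hasDerivAt_det (A := fun z => of fun i j : Fin (n + 1) => F z i j)
    (A' := of fun i j => F s i (j + 1)) fun i j => hF i j).congr_deriv ?_
  rw [Fin.sum_univ_castSucc, Finset.sum_eq_zero, zero_add, wronskianDeriv]
  · congr 1
    ext i j
    cases j using Fin.lastCases with
    | last => simp
    | cast j => simp
  · intro k _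
    have adjacent : k.castSucc ≠ k.succ := Fin.castSucc_lt_succ.ne
    exact det_zero_of_column_eq adjacent fun i => by simp [updateCol_ne adjacent.symm]

theorem hasDerivAt_wronskian_vecCons_div {a b : 𝕜 → ℕ → 𝕜} {F : 𝕜 → Fin n → ℕ → 𝕜}
    (ha : DerivSeqAt a s) (hb : DerivSeqAt b s) (hF : ∀ i, DerivSeqAt (fun z => F z i) s)
    (h : wronskian (vecCons (b s) (F s)) ≠ 0) :
    HasDerivAt (fun z => wronskian (vecCons (a z) (F z)) / wronskian (vecCons (b z) (F z)))
      (-(wronskian (vecCons (a s) (vecCons (b s) (F s))) * wronskian (F s)) /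
        wronskian (vecCons (b s) (F s)) ^ 2) s := by
  rw [wronskian_vecCons_vecCons_mul_wronskian]
  convert! (hasDerivAt_wronskian (F := fun z => vecCons (a z) (F z)) (Fin.cases ha hF)).fun_div
    (hasDerivAt_wronskian (F := fun z => vecCons (b z) (F z)) (Fin.cases hb hF)) h using 2
  ring

variable {E : 𝕜 → ℕ → ℕ → 𝕜}

theorem hasDerivAt_minor_one_one_div (hE : ∀ i, DerivSeqAt (fun z => E z i) s)
    (h : minor (E s) 0 0 (n + 1) ≠ 0) :
    HasDerivAt (fun z => minor (E z) 1 1 n / minor (E z) 0 0 (n + 1))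
      (-(minor (E s) 1 0 n * minor (E s) 0 1 (n + 1)) / minor (E s) 0 0 (n + 1) ^ 2) s := by
  simp only [minor_col_one, minor_zero_zero_succ, add_zero, ← vecCons_comp_val_succ (E s)] at h ⊢
  rw [mul_comm]
  exact hasDerivAt_wronskian_vecCons_div derivSeqAt_single_zero_one (hE 0) (fun i => hE (i + 1)) h

theorem hasDerivAt_minor_zero_one_div (hE : ∀ i, DerivSeqAt (fun z => E z i) s)
    (h : minor (E s) 0 0 (n + 1) ≠ 0) :
    HasDerivAt (fun z => minor (E z) 0 1 n / minor (E z) 0 0 (n + 1))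
      (-(minor (E s) 0 0 n * minor (E s) 0 1 (n + 1)) / minor (E s) 0 0 (n + 1) ^ 2) s := by
  have minor_eq (z) : minor (E z) 0 0 (n + 1) =
      (-1) ^ n * wronskian (vecCons (E z n) fun i : Fin n => E z i) :=
    alternatingMap_comp_val wronskian (E z)
  have minor_one_eq : minor (E s) 0 1 (n + 1) = (-1) ^ n *
      wronskian (vecCons (Pi.single 0 1) (vecCons (E s n) fun i : Fin n => E s i)) := by
    rw [minor_col_one]
    exact alternatingMap_comp_val (wronskian.curryLeft (Pi.single 0 1)) (E s)
  have sign_ne_zero : (-1 : 𝕜) ^ n ≠ 0 := pow_ne_zero n (neg_ne_zero.mpr one_ne_zero)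
  simp only [minor_eq] at h ⊢
  convert! (hasDerivAt_wronskian_vecCons_div derivSeqAt_single_zero_one (hE n)
    (fun i : Fin n => hE i) (right_ne_zero_of_mul h)).div_const ((-1) ^ n) using 1
  · ext z
    rw [minor_col_one, div_div, mul_comm]; rfl
  · rw [minor_one_eq, minor_zero_zero]
    field_simp

theorem hasDerivAt_minor_one_zero_div (hE : ∀ i, DerivSeqAt (fun z => E z i) s)
    (h : minor (E s) 0 0 (n + 1) ≠ 0) :
    HasDerivAt (fun z => minor (E z) 1 0 (n + 1) / minor (E z) 0 0 (n + 1))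
      (minor (E s) 1 0 n * minor (E s) 0 0 (n + 2) / minor (E s) 0 0 (n + 1) ^ 2) s := by
  have minor_one_eq (z) : minor (E z) 1 0 (n + 1) =
      (-1) ^ n * wronskian (vecCons (E z (n + 1)) fun i : Fin n => E z (i + 1)) :=
    alternatingMap_comp_val wronskian fun i => E z (i + 1)
  have minor_eq : minor (E s) 0 0 (n + 2) = (-1) ^ (n + 1) * wronskian (vecCons (E s (n + 1))
      (vecCons (E s 0) fun i : Fin n => E s (i + 1))) := by
    rw [vecCons_comp_val_succ]
    exact alternatingMap_comp_val wronskian (E s)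
  simp only [minor_zero_zero_succ (n := n)] at h ⊢
  convert! (hasDerivAt_wronskian_vecCons_div (hE (n + 1)) (hE 0)
    (fun i : Fin n => hE (i + 1)) h).const_mul ((-1) ^ n) using 1
  · ext z
    rw [minor_one_eq, mul_div_assoc]
  · rw [minor_eq]
    simp only [minor, wronskian_apply, add_zero]
    ring

end Calculus

section Bocher

variable {𝕜 : Type*} {n : ℕ} {s : 𝕜}

theorem hasDerivAt_wronskian_update_div [NontriviallyNormedField 𝕜]
    {F : 𝕜 → Fin n → ℕ → 𝕜} {g : 𝕜 → ℕ → 𝕜}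
    (hF : ∀ i, DerivSeqAt (fun z => F z i) s) (hg : DerivSeqAt g s)
    (hne : wronskian (F s) ≠ 0) (hzero : wronskian (vecCons (g s) (F s)) = 0) (p : Fin n) :
    HasDerivAt (fun z => wronskian (Function.update (F z) p (g z)) / wronskian (F z)) 0 s := by
  obtain _ | n := n
  · exact p.elim0
  have wronskian_eq (z) : wronskian (F z) =
      (-1) ^ (p : ℕ) * wronskian (vecCons (F z p) (p.removeNth (F z))) := by
    rw [← wronskian_insertNth, Fin.insertNth_self_removeNth]
  have wronskian_update_eq (z) : wronskian (Function.update (F z) p (g z)) =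
      (-1) ^ (p : ℕ) * wronskian (vecCons (g z) (p.removeNth (F z))) := by
    rw [← wronskian_insertNth, Fin.insertNth_removeNth]
  have sign_ne_zero : (-1 : 𝕜) ^ (p : ℕ) ≠ 0 := pow_ne_zero _ (neg_ne_zero.mpr one_ne_zero)
  have dependent : wronskian (vecCons (g s) (vecCons (F s p) (p.removeNth (F s)))) = 0 := by
    have h := (wronskian.curryLeft (g s)).map_insertNth p (F s p) (p.removeNth (F s))
    rw [Fin.insertNth_self_removeNth, zsmul_eq_mul] at h
    exact (mul_eq_zero.mp (h.symm.trans hzero)).resolve_left (by simp)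
  simp only [wronskian_eq, wronskian_update_eq, mul_div_mul_left _ _ sign_ne_zero] at hne ⊢
  refine (hasDerivAt_wronskian_vecCons_div hg (hF p) (fun i => hF (p.succAbove i))
    (right_ne_zero_of_mul hne)).congr_deriv ?_
  exact (congrArg (fun d => -(d * _) / _) dependent).trans (by simp)

theorem exists_eq_sum_of_wronskian_vecCons_eq_zero [RCLike 𝕜] {K : Set 𝕜} (hKo : IsOpen K)
    (hK : IsPreconnected K) {F : 𝕜 → Fin n → ℕ → 𝕜} {g : 𝕜 → ℕ → 𝕜}
    (hF : ∀ s ∈ K, ∀ i, DerivSeqAt (fun z => F z i) s) (hg : ∀ s ∈ K, DerivSeqAt g s)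
    (hne : ∀ s ∈ K, wronskian (F s) ≠ 0)
    (hzero : ∀ s ∈ K, wronskian (vecCons (g s) (F s)) = 0) :
    ∃ c : Fin n → 𝕜, ∀ j, ∀ s ∈ K, g s j = ∑ i, c i * F s i j := by
  have hderiv (s) (hs : s ∈ K) :=
    hasDerivAt_wronskian_update_div (hF s hs) (hg s hs) (hne s hs) (hzero s hs)
  obtain rfl | ⟨s₀, hs₀⟩ := K.eq_empty_or_nonempty
  · exact ⟨0, by simp⟩
  refine ⟨fun i => wronskian (Function.update (F s₀) i (g s₀)) / wronskian (F s₀), fun j => ?_⟩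
  induction j with
  | zero =>
    intro s hs
    obtain _ | n := n
    · simpa [wronskian_apply] using hzero s hs
    refine mul_left_cancel₀ (hne s hs) ((wronskian_mul_apply (F s) (g s) 0).trans ?_)
    simp only [Finset.mul_sum]
    refine Finset.sum_congr rfl fun i _ => ?_
    have constant := hKo.is_const_of_deriv_eq_zero hK
      (fun z hz => (hderiv z hz i).differentiableAt.differentiableWithinAt)
      (fun z hz => (hderiv z hz i).deriv) hs hs₀
    rw [← constant, ← mul_assoc, mul_div_cancel₀ _ (hne s hs)]
    rfl
  | succ j ih =>
    intro s hs
    refine (hg s hs j).unique (HasDerivAt.congr_of_eventuallyEq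
      (HasDerivAt.fun_sum fun i _ => (hF s hs i j).const_mul _) ?_)
    filter_upwards [hKo.mem_nhds hs] with z hz using ih z hz

end Bocher

section PartialDerivatives

variable {I J : Set ℝ} {u v : ℝ → ℝ → ℝ} {t x : ℝ}

theorem SmoothOn₂.contDiffAt (hI : IsOpen I) (hJ : IsOpen J) (hu : SmoothOn₂ I J u)
    (ht : t ∈ I) (hx : x ∈ J) : ContDiffAt ℝ ∞ (fun p : ℝ × ℝ => u p.1 p.2) (t, x) :=
  ContDiffOn.contDiffAt hu ((hI.prod hJ).mem_nhds (Set.mk_mem_prod ht hx))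

theorem SmoothOn₂.contDiffOn_left (hu : SmoothOn₂ I J u) (hx : x ∈ J) :
    ContDiffOn ℝ ∞ (fun t => u t x) I :=
  ContDiffOn.comp (g := fun p : ℝ × ℝ => u p.1 p.2) hu
    (contDiffOn_id.prodMk contDiffOn_const) fun _ ht => ⟨ht, hx⟩

theorem SmoothOn₂.contDiffOn_right (hu : SmoothOn₂ I J u) (ht : t ∈ I) :
    ContDiffOn ℝ ∞ (fun x => u t x) J :=
  ContDiffOn.comp (g := fun p : ℝ × ℝ => u p.1 p.2) hu
    (contDiffOn_const.prodMk contDiffOn_id) fun _ hx => ⟨ht, hx⟩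

theorem SmoothOn₂.congr (hu : SmoothOn₂ I J u) (h : ∀ t ∈ I, ∀ x ∈ J, v t x = u t x) :
    SmoothOn₂ I J v :=
  ContDiffOn.congr hu fun p hp => h p.1 hp.1 p.2 hp.2

theorem SmoothOn₂.hasDerivAt_partialT (hI : IsOpen I) (hu : SmoothOn₂ I J u)
    (ht : t ∈ I) (hx : x ∈ J) : HasDerivAt (fun τ => u τ x) (partialT u t x) t :=
  (((hu.contDiffOn_left hx).contDiffAt (hI.mem_nhds ht)).differentiableAt (by simp)).hasDerivAt

theorem SmoothOn₂.hasDerivAt_partialX (hJ : IsOpen J) (hu : SmoothOn₂ I J u)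
    (ht : t ∈ I) (hx : x ∈ J) : HasDerivAt (fun ξ => u t ξ) (partialX u t x) x :=
  (((hu.contDiffOn_right ht).contDiffAt (hJ.mem_nhds hx)).differentiableAt (by simp)).hasDerivAt

theorem SmoothOn₂.partialT_eq_fderiv (hI : IsOpen I) (hJ : IsOpen J) (hu : SmoothOn₂ I J u)
    (ht : t ∈ I) (hx : x ∈ J) :
    partialT u t x = fderiv ℝ (fun p : ℝ × ℝ => u p.1 p.2) (t, x) (1, 0) :=
  (((hu.contDiffAt hI hJ ht hx).differentiableAt (by simp)).hasFDerivAt.comp_hasDerivAt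
    (f := fun τ => (τ, x)) t ((hasDerivAt_id t).prodMk (hasDerivAt_const t x))).deriv

theorem SmoothOn₂.partialX_eq_fderiv (hI : IsOpen I) (hJ : IsOpen J) (hu : SmoothOn₂ I J u)
    (ht : t ∈ I) (hx : x ∈ J) :
    partialX u t x = fderiv ℝ (fun p : ℝ × ℝ => u p.1 p.2) (t, x) (0, 1) :=
  (((hu.contDiffAt hI hJ ht hx).differentiableAt (by simp)).hasFDerivAt.comp_hasDerivAt
    (f := fun ξ => (t, ξ)) x ((hasDerivAt_const x t).prodMk (hasDerivAt_id x))).deriv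

protected theorem SmoothOn₂.partialT (hI : IsOpen I) (hJ : IsOpen J) (hu : SmoothOn₂ I J u) :
    SmoothOn₂ I J (partialT u) :=
  ((ContDiffOn.fderiv_of_isOpen hu (hI.prod hJ) (by simp)).clm_apply contDiffOn_const).congr
    fun _ hp => hu.partialT_eq_fderiv hI hJ hp.1 hp.2

protected theorem SmoothOn₂.partialX (hI : IsOpen I) (hJ : IsOpen J) (hu : SmoothOn₂ I J u) :
    SmoothOn₂ I J (partialX u) :=
  ((ContDiffOn.fderiv_of_isOpen hu (hI.prod hJ) (by simp)).clm_apply contDiffOn_const).congr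
    fun _ hp => hu.partialX_eq_fderiv hI hJ hp.1 hp.2

theorem partialT_congr (hI : IsOpen I) (h : ∀ t ∈ I, ∀ x ∈ J, v t x = u t x)
    (ht : t ∈ I) (hx : x ∈ J) : partialT v t x = partialT u t x :=
  Filter.EventuallyEq.deriv_eq <| Filter.mem_of_superset (hI.mem_nhds ht) fun τ hτ => h τ hτ x hx

theorem partialX_congr (hJ : IsOpen J) (h : ∀ t ∈ I, ∀ x ∈ J, v t x = u t x)
    (ht : t ∈ I) (hx : x ∈ J) : partialX v t x = partialX u t x :=
  Filter.EventuallyEq.deriv_eq <| Filter.mem_of_superset (hJ.mem_nhds hx) fun ξ hξ => h t ht ξ hξ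

theorem SmoothOn₂.partialT_partialX (hI : IsOpen I) (hJ : IsOpen J) (hu : SmoothOn₂ I J u)
    (ht : t ∈ I) (hx : x ∈ J) : partialT (partialX u) t x = partialX (partialT u) t x := by
  set U := fun p : ℝ × ℝ => u p.1 p.2
  have smoothAt := hu.contDiffAt hI hJ ht hx
  have differentiableAt_fderiv : DifferentiableAt ℝ (fderiv ℝ U) (t, x) :=
    (smoothAt.fderiv_right (m := 1) (by norm_cast)).differentiableAt (by simp)
  have rectangle_mem := (hI.prod hJ).mem_nhds (Set.mk_mem_prod ht hx)
  have partialX_eventuallyEq : (fun p : ℝ × ℝ => partialX u p.1 p.2) =ᶠ[nhds (t, x)]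
      fun p => fderiv ℝ U p (0, 1) :=
    Filter.mem_of_superset rectangle_mem fun p hp => hu.partialX_eq_fderiv hI hJ hp.1 hp.2
  have partialT_eventuallyEq : (fun p : ℝ × ℝ => partialT u p.1 p.2) =ᶠ[nhds (t, x)]
      fun p => fderiv ℝ U p (1, 0) :=
    Filter.mem_of_superset rectangle_mem fun p hp => hu.partialT_eq_fderiv hI hJ hp.1 hp.2
  rw [(hu.partialX hI hJ).partialT_eq_fderiv hI hJ ht hx,
    (hu.partialT hI hJ).partialX_eq_fderiv hI hJ ht hx,
    partialX_eventuallyEq.fderiv_eq, partialT_eventuallyEq.fderiv_eq,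
    (differentiableAt_fderiv.hasFDerivAt.clm_apply (hasFDerivAt_const _ _)).fderiv,
    (differentiableAt_fderiv.hasFDerivAt.clm_apply (hasFDerivAt_const _ _)).fderiv]
  simpa using smoothAt.isSymmSndFDerivAt (by simpa using ENat.LEInfty.out) (1, 0) (0, 1)

/-- The infinite array of the partial derivatives `∂_x^i ∂_t^j u` at the point `(t, x)`. -/
noncomputable def jet (u : ℝ → ℝ → ℝ) (t x : ℝ) (i j : ℕ) : ℝ :=
  (partialX^[i] (partialT^[j] u)) t x

protected theorem SmoothOn₂.jet (hI : IsOpen I) (hJ : IsOpen J) (hu : SmoothOn₂ I J u) (i j : ℕ) :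
    SmoothOn₂ I J fun t x => jet u t x i j := by
  have smooth_partialT : SmoothOn₂ I J (partialT^[j] u) :=
    Function.Iterate.rec (SmoothOn₂ I J) hu (fun _ h => h.partialT hI hJ) j
  exact Function.Iterate.rec (SmoothOn₂ I J) smooth_partialT (fun _ h => h.partialX hI hJ) i

theorem partialX_jet (u : ℝ → ℝ → ℝ) (i j : ℕ) :
    partialX (fun t x => jet u t x i j) = fun t x => jet u t x (i + 1) j :=
  (Function.iterate_succ_apply' partialX i _).symm

theorem SmoothOn₂.partialT_jet (hI : IsOpen I) (hJ : IsOpen J) (hu : SmoothOn₂ I J u)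
    (ht : t ∈ I) (hx : x ∈ J) (i j : ℕ) :
    partialT (fun t x => jet u t x i j) t x = jet u t x i (j + 1) := by
  induction i generalizing t x with
  | zero => exact congrFun₂ (Function.iterate_succ_apply' partialT j u).symm t x
  | succ i ih =>
    rw [← partialX_jet, (hu.jet hI hJ i j).partialT_partialX hI hJ ht hx,
      partialX_congr hJ (fun _ ht _ hx => ih ht hx) ht hx, partialX_jet]

theorem SmoothOn₂.derivSeqAt_jet_left (hI : IsOpen I) (hJ : IsOpen J) (hu : SmoothOn₂ I J u)
    (ht : t ∈ I) (hx : x ∈ J) (i : ℕ) : DerivSeqAt (fun τ => jet u τ x i) t := fun j =>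
  ((hu.jet hI hJ i j).hasDerivAt_partialT hI ht hx).congr_deriv (hu.partialT_jet hI hJ ht hx i j)

theorem SmoothOn₂.derivSeqAt_jet_right (hI : IsOpen I) (hJ : IsOpen J) (hu : SmoothOn₂ I J u)
    (ht : t ∈ I) (hx : x ∈ J) (j : ℕ) : DerivSeqAt (fun ξ i => jet u t ξ i j) x := fun i =>
  ((hu.jet hI hJ i j).hasDerivAt_partialX hJ ht hx).congr_deriv
    (congrFun₂ (partialX_jet u i j) t x)

theorem jet_eq (hI : IsOpen I) (hJ : IsOpen J) {E : ℝ → ℝ → ℕ → ℕ → ℝ}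
    (hu : ∀ t ∈ I, ∀ x ∈ J, u t x = E t x 0 0)
    (hleft : ∀ t ∈ I, ∀ x ∈ J, DerivSeqAt (fun τ => E τ x 0) t)
    (hright : ∀ t ∈ I, ∀ x ∈ J, ∀ j, DerivSeqAt (fun ξ i => E t ξ i j) x)
    (ht : t ∈ I) (hx : x ∈ J) (i j : ℕ) : jet u t x i j = E t x i j := by
  induction i generalizing t x with
  | zero =>
    induction j generalizing t x with
    | zero => exact hu t ht x hx
    | succ j ih =>
      refine (congrFun₂ (Function.iterate_succ_apply' partialT j u) t x).trans ?_
      exact (partialT_congr hI (fun _ ht _ hx => ih ht hx) ht hx).trans (hleft t ht x hx j).deriv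
  | succ i ih =>
    rw [← congrFun₂ (partialX_jet u i j) t x]
    exact (partialX_congr hJ (fun _ ht _ hx => ih ht hx) ht hx).trans (hright t ht x hx j i).deriv

theorem SmoothOn₂.jet_partialX_partialT (hI : IsOpen I) (hJ : IsOpen J) (hu : SmoothOn₂ I J u)
    (ht : t ∈ I) (hx : x ∈ J) (i j : ℕ) :
    jet (partialX (partialT u)) t x i j = jet u t x (i + 1) (j + 1) :=
  jet_eq hI hJ (E := fun t x i j => jet u t x (i + 1) (j + 1)) (fun _ _ _ _ => rfl)
    (fun _ ht _ hx j => hu.derivSeqAt_jet_left hI hJ ht hx 1 (j + 1))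
    (fun _ ht _ hx j i => hu.derivSeqAt_jet_right hI hJ ht hx (j + 1) (i + 1)) ht hx i j

theorem SmoothOn₂.w_partialX_partialT (hI : IsOpen I) (hJ : IsOpen J) (hu : SmoothOn₂ I J u)
    (ht : t ∈ I) (hx : x ∈ J) (n : ℕ) :
    w n (partialX (partialT u)) t x = minor (jet u t x) 1 1 n :=
  congrArg Matrix.det <| Matrix.ext fun i j => hu.jet_partialX_partialT hI hJ ht hx i j

theorem contDiffOn_det {ι 𝕜 E 𝔸 : Type*} [Fintype ι] [DecidableEq ι] [NontriviallyNormedField 𝕜]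
    [NormedAddCommGroup E] [NormedSpace 𝕜 E] [NormedCommRing 𝔸] [NormedAlgebra 𝕜 𝔸]
    {n : WithTop ℕ∞} {s : Set E} {A : E → Matrix ι ι 𝔸}
    (h : ∀ i j, ContDiffOn 𝕜 n (fun p => A p i j) s) : ContDiffOn 𝕜 n (fun p => (A p).det) s := by
  simp only [Matrix.det_apply]
  exact ContDiffOn.sum fun σ _ => (contDiffOn_prod fun i _ => h _ _).const_smul (Equiv.Perm.sign σ)

theorem SmoothOn₂.minor_jet (hI : IsOpen I) (hJ : IsOpen J) (hu : SmoothOn₂ I J u) (r c n : ℕ) :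
    SmoothOn₂ I J fun t x => minor (jet u t x) r c n :=
  contDiffOn_det (A := fun p : ℝ × ℝ => Matrix.of fun i j : Fin n =>
    jet u p.1 p.2 (i + r) (j + c)) fun _ _ => hu.jet hI hJ _ _

end PartialDerivatives

section Ratio

/-- The numerators of the lattice variables in terms of the array `A` of partial derivatives,
shifted so that the boundary value `v_0 = a` has the numerator `0`. -/
def numerator {R : Type*} [CommRing R] (A : ℕ → ℕ → R) : ℕ → R
  | 0 => 0
  | n + 1 => minor A 1 1 n

theorem numerator_succ_mul_sub {R : Type*} [CommRing R] (A : ℕ → ℕ → R) (n : ℕ) :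
    numerator A (n + 1) * minor A 0 0 n - numerator A n * minor A 0 0 (n + 1) =
      minor A 1 0 n * minor A 0 1 n := by
  cases n with
  | zero => simp [numerator]
  | succ n => exact minor_one_one_mul_sub A n

/-- The right-hand side of formula (2), with the entries `β_{kl}` replaced by the partial
derivatives `∂_x^{k-1} ∂_t^{l-1} u`. -/
noncomputable def minorRatio (u : ℝ → ℝ → ℝ) (a : ℝ) (n : ℕ) (t x : ℝ) : ℝ :=
  numerator (jet u t x) n / minor (jet u t x) 0 0 n + a

variable {I J : Set ℝ} {u : ℝ → ℝ → ℝ} {a t x : ℝ} {n : ℕ}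

theorem SmoothOn₂.minorRatio (hI : IsOpen I) (hJ : IsOpen J) (hu : SmoothOn₂ I J u)
    (hne : ∀ t ∈ I, ∀ x ∈ J, minor (jet u t x) 0 0 n ≠ 0) : SmoothOn₂ I J (minorRatio u a n) := by
  have smooth_numerator : SmoothOn₂ I J fun t x => numerator (jet u t x) n := by
    cases n with
    | zero => exact contDiffOn_const
    | succ n => exact hu.minor_jet hI hJ 1 1 n
  exact (smooth_numerator.div (hu.minor_jet hI hJ 0 0 n) fun p hp =>
    hne p.1 hp.1 p.2 hp.2).add contDiffOn_const

theorem SmoothOn₂.partialT_minorRatio (hI : IsOpen I) (hJ : IsOpen J) (hu : SmoothOn₂ I J u)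
    (ht : t ∈ I) (hx : x ∈ J) (hne : minor (jet u t x) 0 0 (n + 1) ≠ 0) :
    partialT (FSY.minorRatio u a (n + 1)) t x =
      -(minor (jet u t x) 1 0 n * minor (jet u t x) 0 1 (n + 1)) /
        minor (jet u t x) 0 0 (n + 1) ^ 2 :=
  ((hasDerivAt_minor_one_one_div (hu.derivSeqAt_jet_left hI hJ ht hx) hne).add_const a).deriv

theorem SmoothOn₂.partialX_minorRatio (hI : IsOpen I) (hJ : IsOpen J) (hu : SmoothOn₂ I J u)
    (ht : t ∈ I) (hx : x ∈ J) (hne : minor (jet u t x) 0 0 (n + 1) ≠ 0) :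
    partialX (FSY.minorRatio u a (n + 1)) t x =
      -(minor (jet u t x) 0 1 n * minor (jet u t x) 1 0 (n + 1)) /
        minor (jet u t x) 0 0 (n + 1) ^ 2 := by
  have h := hasDerivAt_minor_one_one_div (n := n) (E := fun ξ i j => jet u t ξ j i)
    (hu.derivSeqAt_jet_right hI hJ ht hx)
  simp only [minor_transpose] at h
  exact ((h hne).add_const a).deriv

theorem SmoothOn₂.partialX_partialT_minorRatio (hI : IsOpen I) (hJ : IsOpen J)
    (hu : SmoothOn₂ I J u) (hne : ∀ t ∈ I, ∀ x ∈ J, minor (jet u t x) 0 0 (n + 1) ≠ 0)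
    (ht : t ∈ I) (hx : x ∈ J) :
    partialX (partialT (FSY.minorRatio u a (n + 1))) t x =
      (minor (jet u t x) 0 0 n * minor (jet u t x) 1 0 (n + 1) * minor (jet u t x) 0 1 (n + 1) -
        minor (jet u t x) 1 0 n * minor (jet u t x) 0 1 n * minor (jet u t x) 0 0 (n + 2)) /
          minor (jet u t x) 0 0 (n + 1) ^ 3 := by
  have partialX_eq : ∀ t ∈ I, ∀ x ∈ J, partialX (FSY.minorRatio u a (n + 1)) t x =
      -(minor (jet u t x) 0 1 n / minor (jet u t x) 0 0 (n + 1) *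
        (minor (jet u t x) 1 0 (n + 1) / minor (jet u t x) 0 0 (n + 1))) := fun t ht x hx => by
    rw [hu.partialX_minorRatio hI hJ ht hx (hne t ht x hx), div_mul_div_comm, neg_div, sq]
  have rows := hu.derivSeqAt_jet_left hI hJ ht hx
  have hasDerivAt_product := ((hasDerivAt_minor_zero_one_div rows (hne t ht x hx)).fun_mul
    (hasDerivAt_minor_one_zero_div rows (hne t ht x hx))).fun_neg
  rw [← (hu.minorRatio hI hJ hne).partialT_partialX hI hJ ht hx,
    partialT_congr hI partialX_eq ht hx]
  refine hasDerivAt_product.deriv.trans ?_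
  have ne_zero := hne t ht x hx
  field_simp
  ring

theorem minor_mul_minorRatio_sub (hn : minor (jet u t x) 0 0 n ≠ 0)
    (hn' : minor (jet u t x) 0 0 (n + 1) ≠ 0) :
    minor (jet u t x) 0 0 (n + 1) * minor (jet u t x) 0 0 n *
      (minorRatio u a (n + 1) t x - minorRatio u a n t x) =
        minor (jet u t x) 1 0 n * minor (jet u t x) 0 1 n := by
  rw [← numerator_succ_mul_sub, minorRatio, minorRatio]
  field_simp
  ring

/-- On `I × J`, the components `v_n` with `n < N` are given by formula (2), with the derivatives of
`u` in place of the entries of `β`. -/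
def IsMinorRatio (N : ℕ) (a : ℝ) (I J : Set ℝ) (u : ℝ → ℝ → ℝ) (v : ℕ → ℝ → ℝ → ℝ) : Prop :=
  ∀ n < N, ∀ t ∈ I, ∀ x ∈ J,
    minor (jet u t x) 0 0 n ≠ 0 ∧ v n t x = minorRatio u a n t x

end Ratio

section Lattice

variable {N : ℕ} {a : ℝ} {I J : Set ℝ} {u : ℝ → ℝ → ℝ} {v : ℕ → ℝ → ℝ → ℝ} {n : ℕ} {t x : ℝ}

theorem lattice_identity_iff {K : Type*} [Field K] {τ₀ τ₁ τ₂ p₀ p₁ q₀ q₁ b c : K} (hτ₀ : τ₀ ≠ 0)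
    (hτ₁ : τ₁ ≠ 0) (hb : b ≠ 0) (hc : c ≠ 0) (hpq : τ₁ * τ₀ * b = p₀ * q₀) :
    (τ₀ * p₁ * q₁ - p₀ * q₀ * τ₂) / τ₁ ^ 3 =
        -(p₀ * q₁) / τ₁ ^ 2 * (-(q₀ * p₁) / τ₁ ^ 2) * (1 / b - 1 / c) ↔
      τ₂ * τ₁ * c = p₁ * q₁ := by
  have difference : (τ₀ * p₁ * q₁ - p₀ * q₀ * τ₂) / τ₁ ^ 3 -
      -(p₀ * q₁) / τ₁ ^ 2 * (-(q₀ * p₁) / τ₁ ^ 2) * (1 / b - 1 / c) =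
        τ₀ * b / (τ₁ ^ 3 * c) * (p₁ * q₁ - τ₂ * τ₁ * c) := by
    have product : -(p₀ * q₁) / τ₁ ^ 2 * (-(q₀ * p₁) / τ₁ ^ 2) =
        τ₁ * τ₀ * b * (p₁ * q₁) / τ₁ ^ 4 := by
      rw [hpq]
      ring
    rw [product, ← hpq]
    field_simp
    ring
  rw [← sub_eq_zero, difference, mul_eq_zero, or_iff_right (by positivity), sub_eq_zero, eq_comm]

theorem IsMinorRatio.sub_mul_minor (h : IsMinorRatio N a I J u v) (hn : n < N)
    (ht : t ∈ I) (hx : x ∈ J) :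
    (v n t x - a) * minor (jet u t x) 0 0 n = numerator (jet u t x) n := by
  obtain ⟨ne_zero, eq⟩ := h n hn t ht x hx
  rw [eq, minorRatio, add_sub_cancel_right, div_mul_cancel₀ _ ne_zero]

theorem IsMinorRatio.minor_mul_sub (h : IsMinorRatio N a I J u v) (hn : n + 1 < N)
    (ht : t ∈ I) (hx : x ∈ J) :
    minor (jet u t x) 0 0 (n + 1) * minor (jet u t x) 0 0 n * (v (n + 1) t x - v n t x) =
      minor (jet u t x) 1 0 n * minor (jet u t x) 0 1 n := by
  obtain ⟨ne_zero, eq⟩ := h n (by omega) t ht x hx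
  obtain ⟨ne_zero', eq'⟩ := h (n + 1) hn t ht x hx
  rw [eq, eq', minor_mul_minorRatio_sub ne_zero ne_zero']

theorem IsMinorRatio.partialT_eq (h : IsMinorRatio N a I J u v) (hI : IsOpen I) (hJ : IsOpen J)
    (hu : SmoothOn₂ I J u) (hn : n + 1 < N) (ht : t ∈ I) (hx : x ∈ J) :
    partialT (v (n + 1)) t x = -(minor (jet u t x) 1 0 n * minor (jet u t x) 0 1 (n + 1)) /
      minor (jet u t x) 0 0 (n + 1) ^ 2 := by
  rw [partialT_congr hI (fun t ht x hx => (h _ hn t ht x hx).2) ht hx,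
    hu.partialT_minorRatio hI hJ ht hx (h _ hn t ht x hx).1]

theorem IsMinorRatio.partialX_eq (h : IsMinorRatio N a I J u v) (hI : IsOpen I) (hJ : IsOpen J)
    (hu : SmoothOn₂ I J u) (hn : n + 1 < N) (ht : t ∈ I) (hx : x ∈ J) :
    partialX (v (n + 1)) t x = -(minor (jet u t x) 0 1 n * minor (jet u t x) 1 0 (n + 1)) /
      minor (jet u t x) 0 0 (n + 1) ^ 2 := by
  rw [partialX_congr hJ (fun t ht x hx => (h _ hn t ht x hx).2) ht hx,
    hu.partialX_minorRatio hI hJ ht hx (h _ hn t ht x hx).1]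

theorem IsMinorRatio.latticeEq_iff (h : IsMinorRatio N a I J u v) (hI : IsOpen I) (hJ : IsOpen J)
    (hu : SmoothOn₂ I J u) (hn : n + 1 < N) (ht : t ∈ I) (hx : x ∈ J)
    (hne : v n t x ≠ v (n + 1) t x) (hne' : v (n + 1) t x ≠ v (n + 2) t x) :
    LatticeEq v (n + 1) t x ↔
      (v (n + 2) t x - a) * minor (jet u t x) 0 0 (n + 2) = minor (jet u t x) 1 1 (n + 1) := by
  have ne_zero := (h (n + 1) hn t ht x hx).1
  have numerator_eq : (v (n + 1) t x - a) * minor (jet u t x) 0 0 (n + 1) =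
      minor (jet u t x) 1 1 n := h.sub_mul_minor hn ht hx
  have mixed : partialX (partialT (v (n + 1))) t x = _ :=
    (partialX_congr hJ (fun _ ht _ hx => partialT_congr hI (fun t ht x hx => (h _ hn t ht x hx).2)
      ht hx) ht hx).trans <|
    hu.partialX_partialT_minorRatio hI hJ (fun t ht x hx => (h _ hn t ht x hx).1) ht hx
  rw [LatticeEq, mixed, h.partialT_eq hI hJ hu hn ht hx, h.partialX_eq hI hJ hu hn ht hx,
    Nat.add_sub_cancel, lattice_identity_iff (h n (by omega) t ht x hx).1 ne_zero
      (sub_ne_zero.mpr hne.symm) (sub_ne_zero.mpr hne'.symm) (h.minor_mul_sub hn ht hx),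
    ← minor_one_one_mul_sub]
  refine ⟨fun eqn => mul_right_cancel₀ ne_zero ?_, fun eqn => ?_⟩
  · linear_combination eqn + minor (jet u t x) 0 0 (n + 2) * numerator_eq
  · linear_combination minor (jet u t x) 0 0 (n + 1) * eqn -
      minor (jet u t x) 0 0 (n + 2) * numerator_eq

theorem IsMinorRatio.minor_ne_zero_and_eq (h : IsMinorRatio N a I J u v) (hI : IsOpen I)
    (hJ : IsOpen J) (hu : SmoothOn₂ I J u) (hn : n + 1 < N) (ht : t ∈ I) (hx : x ∈ J)
    (hne : v n t x ≠ v (n + 1) t x) (hne' : v (n + 1) t x ≠ v (n + 2) t x)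
    (heqn : LatticeEq v (n + 1) t x) (hT : partialT (v (n + 1)) t x ≠ 0)
    (hX : partialX (v (n + 1)) t x ≠ 0) :
    minor (jet u t x) 0 0 (n + 2) ≠ 0 ∧ v (n + 2) t x = minorRatio u a (n + 2) t x := by
  have numerator_eq := (h.latticeEq_iff hI hJ hu hn ht hx hne hne').mp heqn
  have ne_zero : minor (jet u t x) 0 0 (n + 2) ≠ 0 := fun eq_zero => by
    have product_eq_zero := minor_one_one_mul_sub (jet u t x) n
    rw [← numerator_eq, eq_zero, mul_zero, zero_mul, mul_zero, sub_zero] at product_eq_zero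
    rcases mul_eq_zero.mp product_eq_zero.symm with hp | hq
    · exact hX (by rw [h.partialX_eq hI hJ hu hn ht hx, hp]; simp)
    · exact hT (by rw [h.partialT_eq hI hJ hu hn ht hx, hq]; simp)
  exact ⟨ne_zero, by rw [minorRatio, numerator, ← numerator_eq]; field_simp; ring⟩

theorem IsMinorRatio.minor_ne_zero (h : IsMinorRatio N a I J u v) (hn : n + 1 < N)
    (ht : t ∈ I) (hx : x ∈ J) (hne : v n t x ≠ v (n + 1) t x) :
    minor (jet u t x) 1 0 n ≠ 0 ∧ minor (jet u t x) 0 1 n ≠ 0 := by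
  rw [← mul_ne_zero_iff, ← h.minor_mul_sub hn ht hx]
  exact mul_ne_zero (mul_ne_zero (h _ hn t ht x hx).1 (h n (by omega) t ht x hx).1)
    (sub_ne_zero.mpr hne.symm)

theorem IsMinorRatio.generic (h : IsMinorRatio N a I J u v) (hI : IsOpen I) (hJ : IsOpen J)
    (hu : SmoothOn₂ I J u) (hne : ∀ n < N, ∀ t ∈ I, ∀ x ∈ J, v n t x ≠ v (n + 1) t x) :
    Generic N I J v := by
  intro n hn hnN t ht x hx
  obtain ⟨n, rfl⟩ := Nat.exists_eq_add_of_le' hn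
  obtain ⟨hp, hq⟩ := h.minor_ne_zero (by omega) ht hx (hne n (by omega) t ht x hx)
  obtain ⟨hp', hq'⟩ := h.minor_ne_zero (by omega) ht hx (hne (n + 1) (by omega) t ht x hx)
  have ne_zero := pow_ne_zero 2 (h (n + 1) (by omega) t ht x hx).1
  rw [h.partialT_eq hI hJ hu (by omega) ht hx, h.partialX_eq hI hJ hu (by omega) ht hx]
  exact ⟨div_ne_zero (neg_ne_zero.mpr (mul_ne_zero hp hq')) ne_zero,
    div_ne_zero (neg_ne_zero.mpr (mul_ne_zero hq hp')) ne_zero⟩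

theorem IsMinorRatio.isSolution (h : IsMinorRatio N a I J u v) (hI : IsOpen I) (hJ : IsOpen J)
    (hu : SmoothOn₂ I J u) (hv : Admissible N a I J v)
    (hzero : ∀ t ∈ I, ∀ x ∈ J, minor (jet u t x) 1 1 (N - 1) = 0) : IsSolution N a I J v where
  toAdmissible := hv
  smooth n hn := by
    rcases hn.lt_or_eq with hn | rfl
    · exact (hu.minorRatio hI hJ fun t ht x hx => (h n hn t ht x hx).1).congr fun t ht x hx =>
        (h n hn t ht x hx).2
    · exact SmoothOn₂.congr (u := fun _ _ => a) contDiffOn_const hv.right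
  eqn n hn hnN t ht x hx := by
    obtain ⟨n, rfl⟩ := Nat.exists_eq_add_of_le' hn
    rw [h.latticeEq_iff hI hJ hu (by omega) ht hx (hv.ne _ (by omega) t ht x hx)
      (hv.ne _ (by omega) t ht x hx)]
    rcases hnN.lt_or_eq with hlt | rfl
    · exact h.sub_mul_minor hlt ht hx
    · rw [hv.right t ht x hx, sub_self, zero_mul]
      exact (hzero t ht x hx).symm

theorem IsSolution.smoothOn₂_inv (hv : IsSolution N a I J v) (hN : 0 < N) :
    SmoothOn₂ I J fun t x => (v 1 t x - a)⁻¹ :=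
  ContDiffOn.inv (ContDiffOn.sub (hv.smooth 1 hN) contDiffOn_const) fun p hp => by
    rw [← hv.left p.1 hp.1 p.2 hp.2]
    exact sub_ne_zero.mpr (hv.ne 0 hN p.1 hp.1 p.2 hp.2).symm

theorem IsSolution.isMinorRatio (hv : IsSolution N a I J v) (hI : IsOpen I) (hJ : IsOpen J)
    (hg : Generic N I J v) : IsMinorRatio N a I J (fun t x => (v 1 t x - a)⁻¹) v := by
  suffices ∀ M ≤ N, IsMinorRatio M a I J (fun t x => (v 1 t x - a)⁻¹) v from this N le_rfl
  intro M hM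
  induction M with
  | zero => exact fun n hn => absurd hn n.not_lt_zero
  | succ M ih =>
    intro n hn t ht x hx
    rcases (Nat.lt_succ_iff.mp hn).lt_or_eq with hlt | rfl
    · exact ih (by omega) n hlt t ht x hx
    have hu := hv.smoothOn₂_inv (by omega)
    match n with
    | 0 => exact ⟨by simp, by simp [minorRatio, numerator, hv.left t ht x hx]⟩
    | 1 =>
      have ne_zero : v 1 t x - a ≠ 0 := by
        rw [← hv.left t ht x hx]
        exact sub_ne_zero.mpr (hv.ne 0 (by omega) t ht x hx).symm
      simp [minorRatio, numerator, minor, jet, ne_zero]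
    | n + 2 =>
      obtain ⟨hT, hX⟩ := hg (n + 1) (by omega) (by omega) t ht x hx
      exact (ih (by omega)).minor_ne_zero_and_eq hI hJ hu (by omega) ht hx
        (hv.ne n (by omega) t ht x hx) (hv.ne (n + 1) (by omega) t ht x hx)
        (hv.eqn (n + 1) (by omega) (by omega) t ht x hx) hT hX

end Lattice

section Separation

variable {I J : Set ℝ} {u f : ℝ → ℝ → ℝ} {t₀ x₀ : ℝ} {m : ℕ}

theorem wronskian_eq_zero_of_last_eq_sum {R : Type*} [CommRing R] [IsDomain R]
    {F : Fin (m + 1) → ℕ → R} {c : Fin m → R} (h : ∀ k, F k m = ∑ i, c i * F k i) :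
    wronskian F = 0 := by
  refine exists_mulVec_eq_zero_iff.mp ⟨Fin.snoc c (-1), fun h => ?_, funext fun k => ?_⟩
  · simpa using congrFun h (Fin.last m)
  · change ∑ i : Fin (m + 1), F k i * Fin.snoc (α := fun _ => R) c (-1) i = 0
    simp [Fin.sum_univ_castSucc, h, mul_comm]

-- Bôcher's theorem in `t` gives relations between the rows of the array with coefficients depending
-- on `x` only; evaluated at `t` and `t₀` together, they make a Wronskian in `x` vanish.
theorem SmoothOn₂.exists_jet_eq_sum (hIo : IsOpen I) (hI : I.OrdConnected) (hJo : IsOpen J)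
    (hJ : J.OrdConnected) (hf : SmoothOn₂ I J f)
    (hzero : ∀ t ∈ I, ∀ x ∈ J, w (m + 1) f t x = 0) (hne : ∀ t ∈ I, ∀ x ∈ J, w m f t x ≠ 0)
    (ht₀ : t₀ ∈ I) {t : ℝ} (ht : t ∈ I) :
    ∃ c : Fin m → ℝ, ∀ i, ∀ x ∈ J, jet f t x i 0 = ∑ s, c s * jet f t₀ x i s := by
  have exists_row_relation (x) (hx : x ∈ J) : ∃ c : Fin m → ℝ, ∀ j, ∀ t ∈ I,
      jet f t x m j = ∑ i, c i * jet f t x i j := by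
    refine exists_eq_sum_of_wronskian_vecCons_eq_zero hIo hI.isPreconnected
      (F := fun τ i => jet f τ x i) (g := fun τ => jet f τ x m)
      (fun t ht i => hf.derivSeqAt_jet_left hIo hJo ht hx i)
      (fun t ht => hf.derivSeqAt_jet_left hIo hJo ht hx m) (fun t ht => hne t ht x hx)
      fun t ht => ?_
    have h := (alternatingMap_comp_val wronskian (jet f t x)).symm.trans (hzero t ht x hx)
    exact (mul_eq_zero.mp h).resolve_left (by simp)
  refine exists_eq_sum_of_wronskian_vecCons_eq_zero hJo hJ.isPreconnected
    (F := fun ξ s i => jet f t₀ ξ i s) (g := fun ξ i => jet f t ξ i 0)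
    (fun x hx s => hf.derivSeqAt_jet_right hIo hJo ht₀ hx s)
    (fun x hx => hf.derivSeqAt_jet_right hIo hJo ht hx 0) (fun x hx => ?_) fun x hx => ?_
  · exact (minor_transpose (jet f t₀ x) 0 0 m).trans_ne (hne t₀ ht₀ x hx)
  · obtain ⟨c, hc⟩ := exists_row_relation x hx
    exact wronskian_eq_zero_of_last_eq_sum (Fin.cases (hc 0 t ht) fun s => hc s t₀ ht₀)

theorem SmoothOn₂.exists_eq_sum_mul (hIo : IsOpen I) (hI : I.OrdConnected) (hJo : IsOpen J)
    (hJ : J.OrdConnected) (hf : SmoothOn₂ I J f)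
    (hzero : ∀ t ∈ I, ∀ x ∈ J, w (m + 1) f t x = 0) (hne : ∀ t ∈ I, ∀ x ∈ J, w m f t x ≠ 0)
    (ht₀ : t₀ ∈ I) (hx₀ : x₀ ∈ J) :
    ∃ Y S : Fin m → ℝ → ℝ, (∀ s, ContDiffOn ℝ ∞ (Y s) J) ∧ (∀ s, ContDiffOn ℝ ∞ (S s) I) ∧
      ∀ t ∈ I, ∀ x ∈ J, f t x = ∑ s, Y s x * S s t := by
  let M : Matrix (Fin m) (Fin m) ℝ := of fun i s => jet f t₀ x₀ i s
  refine ⟨fun s x => jet f t₀ x 0 s, fun s t => (M⁻¹ *ᵥ fun i => jet f t x₀ i 0) s,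
    fun s => (hf.jet hIo hJo 0 s).contDiffOn_right ht₀, fun s => ?_, fun t ht x hx => ?_⟩
  · simp only [mulVec, dotProduct]
    exact ContDiffOn.sum fun i _ => contDiffOn_const.mul ((hf.jet hIo hJo i 0).contDiffOn_left hx₀)
  · obtain ⟨c, hc⟩ := hf.exists_jet_eq_sum hIo hI hJo hJ hzero hne ht₀ ht
    have eq_mulVec : (fun i : Fin m => jet f t x₀ i 0) = M *ᵥ c := funext fun i =>
      (hc i x₀ hx₀).trans (Finset.sum_congr rfl fun s _ => mul_comm _ _)
    have isUnit_det : IsUnit M.det := (hne t₀ ht₀ x₀ hx₀).isUnit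
    simp only [eq_mulVec, mulVec_mulVec, nonsing_inv_mul M isUnit_det, one_mulVec]
    exact (hc 0 x hx).trans (Finset.sum_congr rfl fun s _ => mul_comm _ _)

theorem exists_contDiffOn_hasDerivAt {K : Set ℝ} (hKo : IsOpen K) (hK : K.OrdConnected) {f : ℝ → ℝ}
    (hf : ContDiffOn ℝ ∞ f K) {s₀ : ℝ} (hs₀ : s₀ ∈ K) :
    ∃ F : ℝ → ℝ, ContDiffOn ℝ ∞ F K ∧ ∀ s ∈ K, HasDerivAt F (f s) s := by
  have hasDerivAt_integral : ∀ s ∈ K, HasDerivAt (fun s => ∫ z in s₀..s, f z) (f s) s :=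
    fun s hs => intervalIntegral.integral_hasDerivAt_right
      (hf.continuousOn.mono (hK.uIcc_subset hs₀ hs)).intervalIntegrable
      (hf.continuousOn.stronglyMeasurableAtFilter hKo s hs)
      (hf.continuousOn.continuousAt (hKo.mem_nhds hs))
  refine ⟨_, ?_, hasDerivAt_integral⟩
  rw [contDiffOn_infty_iff_deriv_of_isOpen hKo]
  exact ⟨fun s hs => (hasDerivAt_integral s hs).differentiableAt.differentiableWithinAt,
    hf.congr fun s hs => (hasDerivAt_integral s hs).deriv⟩

theorem SmoothOn₂.eq_add_of_partialX_partialT_eq_zero (hIo : IsOpen I) (hI : I.OrdConnected)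
    (hJo : IsOpen J) (hJ : J.OrdConnected) (hu : SmoothOn₂ I J u)
    (h : ∀ t ∈ I, ∀ x ∈ J, partialX (partialT u) t x = 0) (ht₀ : t₀ ∈ I) (hx₀ : x₀ ∈ J) :
    ∀ t ∈ I, ∀ x ∈ J, u t x = u t₀ x + (u t x₀ - u t₀ x₀) := by
  intro t ht x hx
  have partialT_eq : ∀ z ∈ I, partialT u z x = partialT u z x₀ := fun z hz =>
    hJo.is_const_of_deriv_eq_zero hJ.isPreconnected (((hu.partialT hIo hJo).contDiffOn_right
      hz).differentiableOn (by simp)) (fun y hy => h z hz y hy) hx hx₀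
  have hasDerivAt_sub : ∀ z ∈ I, HasDerivAt (fun z => u z x - u z x₀) 0 z := fun z hz => by
    simpa [partialT_eq z hz] using
      (hu.hasDerivAt_partialT hIo hz hx).fun_sub (hu.hasDerivAt_partialT hIo hz hx₀)
  have sub_eq : u t x - u t x₀ = u t₀ x - u t₀ x₀ :=
    hIo.is_const_of_deriv_eq_zero hI.isPreconnected
      (fun z hz => (hasDerivAt_sub z hz).differentiableAt.differentiableWithinAt)
      (fun z hz => (hasDerivAt_sub z hz).deriv) ht ht₀
  linarith

theorem smoothOn₂_mul {f g : ℝ → ℝ} (hf : ContDiffOn ℝ ∞ f J) (hg : ContDiffOn ℝ ∞ g I) :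
    SmoothOn₂ I J fun t x => f x * g t :=
  (hf.comp contDiffOn_snd fun _ hp => hp.2).mul (hg.comp contDiffOn_fst fun _ hp => hp.1)

theorem SmoothOn₂.exists_eq_add_add_sum (hIo : IsOpen I) (hI : I.OrdConnected)
    (hJo : IsOpen J) (hJ : J.OrdConnected) (hu : SmoothOn₂ I J u) (ht₀ : t₀ ∈ I) (hx₀ : x₀ ∈ J)
    {ι : Type*} [Fintype ι] {Y S Y' S' : ι → ℝ → ℝ}
    (hY : ∀ s, ContDiffOn ℝ ∞ (Y s) J) (hS : ∀ s, ContDiffOn ℝ ∞ (S s) I)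
    (hY' : ∀ s, ∀ x ∈ J, HasDerivAt (Y s) (Y' s x) x)
    (hS' : ∀ s, ∀ t ∈ I, HasDerivAt (S s) (S' s t) t)
    (h : ∀ t ∈ I, ∀ x ∈ J, partialX (partialT u) t x = ∑ s, Y' s x * S' s t) :
    ∃ A B : ℝ → ℝ, ContDiffOn ℝ ∞ A J ∧ ContDiffOn ℝ ∞ B I ∧
      ∀ t ∈ I, ∀ x ∈ J, u t x = A x + B t + ∑ s, Y s x * S s t := by
  let g : ℝ → ℝ → ℝ := fun t x => u t x - ∑ s, Y s x * S s t
  have hg : SmoothOn₂ I J g :=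
    ContDiffOn.sub hu (ContDiffOn.sum fun s _ => smoothOn₂_mul (hY s) (hS s))
  have partialT_g : ∀ t ∈ I, ∀ x ∈ J,
      partialT g t x = partialT u t x - ∑ s, Y s x * S' s t := fun t ht x hx =>
    ((hu.hasDerivAt_partialT hIo ht hx).fun_sub
      (HasDerivAt.fun_sum fun s _ => (hS' s t ht).const_mul (Y s x))).deriv
  have mixed_eq_zero : ∀ t ∈ I, ∀ x ∈ J, partialX (partialT g) t x = 0 := fun t ht x hx =>
    (partialX_congr hJo partialT_g ht hx).trans <| HasDerivAt.deriv <| by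
      simpa [h t ht x hx] using ((hu.partialT hIo hJo).hasDerivAt_partialX hJo ht hx).fun_sub
        (HasDerivAt.fun_sum fun s (_ : s ∈ Finset.univ) => (hY' s x hx).mul_const (S' s t))
  refine ⟨fun x => g t₀ x, fun t => g t x₀ - g t₀ x₀, hg.contDiffOn_right ht₀,
    (hg.contDiffOn_left hx₀).sub contDiffOn_const, fun t ht x hx => ?_⟩
  rw [← hg.eq_add_of_partialX_partialT_eq_zero hIo hI hJo hJ mixed_eq_zero ht₀ hx₀ t ht x hx,
    sub_add_cancel]

theorem sum_Icc_one_eq_sum_fin {M : Type*} [AddCommMonoid M] (m : ℕ) (f : ℕ → M) :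
    ∑ s ∈ Finset.Icc 1 m, f s = ∑ s : Fin m, f (s + 1) := by
  rw [Fin.sum_univ_eq_sum_range (fun s => f (s + 1)), Finset.range_eq_Ico,
    Finset.sum_Ico_add' f 0 m 1]
  rfl

theorem SmoothOn₂.exists_isSeparatedSum {N : ℕ} (hN : 2 ≤ N) (hIo : IsOpen I) (hI : I.OrdConnected)
    (hJo : IsOpen J) (hJ : J.OrdConnected) (hu : SmoothOn₂ I J u)
    (hzero : ∀ t ∈ I, ∀ x ∈ J, w (N - 1) (partialX (partialT u)) t x = 0)
    (hne : ∀ t ∈ I, ∀ x ∈ J, w (N - 2) (partialX (partialT u)) t x ≠ 0) :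
    ∃ X T : ℕ → ℝ → ℝ, SmoothData N I J X T ∧ IsSeparatedSum N I J X T u := by
  obtain ⟨m, rfl⟩ := Nat.exists_eq_add_of_le' hN
  rcases I.eq_empty_or_nonempty with rfl | ⟨t₀, ht₀⟩
  · exact ⟨0, 0, fun _ _ => ⟨contDiffOn_const, contDiffOn_const⟩, fun _ ht => ht.elim⟩
  rcases J.eq_empty_or_nonempty with rfl | ⟨x₀, hx₀⟩
  · exact ⟨0, 0, fun _ _ => ⟨contDiffOn_const, contDiffOn_const⟩, fun _ _ _ hx => hx.elim⟩
  obtain ⟨Y', S', smooth_Y', smooth_S', mixed_eq⟩ := ((hu.partialT hIo hJo).partialX hIo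
    hJo).exists_eq_sum_mul (m := m) hIo hI hJo hJ hzero hne ht₀ hx₀
  choose Y hY hY' using fun s => exists_contDiffOn_hasDerivAt hJo hJ (smooth_Y' s) hx₀
  choose S hS hS' using fun s => exists_contDiffOn_hasDerivAt hIo hI (smooth_S' s) ht₀
  obtain ⟨A, B, hA, hB, hAB⟩ :=
    hu.exists_eq_add_add_sum hIo hI hJo hJ ht₀ hx₀ hY hS hY' hS' mixed_eq
  let X : Fin (m + 1) → ℝ → ℝ := Fin.cons A Y
  let T : Fin (m + 1) → ℝ → ℝ := Fin.cons B S
  have hX (s) : ContDiffOn ℝ ∞ (X s) J := Fin.cases hA hY s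
  have hT (s) : ContDiffOn ℝ ∞ (T s) I := Fin.cases hB hS s
  refine ⟨fun s => X (Fin.ofNat (m + 1) s), fun s => T (Fin.ofNat (m + 1) s),
    fun s _ => ⟨hT _, hX _⟩, fun t ht x hx => ?_⟩
  have ofNat_succ (s : Fin m) : Fin.ofNat (m + 1) (s + 1) = s.succ := Fin.ofNat_val_eq_self s.succ
  rw [hAB t ht x hx, Nat.add_sub_cancel, sum_Icc_one_eq_sum_fin]
  simp only [ofNat_succ]
  rfl

end Separation

section SeparatedSum

theorem hasDerivAt_iteratedDeriv {𝕜 F : Type*} [NontriviallyNormedField 𝕜] [NormedAddCommGroup F]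
    [NormedSpace 𝕜 F] {f : 𝕜 → F} {s : 𝕜} (hf : ContDiffAt 𝕜 ∞ f s) (n : ℕ) :
    HasDerivAt (iteratedDeriv n f) (iteratedDeriv (n + 1) f s) s := by
  have differentiableAt : DifferentiableAt 𝕜 (iteratedDeriv n f) s := by
    rw [← differentiableWithinAt_univ, ← iteratedDerivWithin_univ]
    exact hf.contDiffWithinAt.differentiableWithinAt_iteratedDerivWithin
      (by exact_mod_cast WithTop.coe_lt_top _) (by simp)
  simpa only [iteratedDeriv_succ] using differentiableAt.hasDerivAt

/-- The infinite array of the `β_{kl}`, with the indices `k` and `l` starting at `0`. -/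
noncomputable def betaEntry (N : ℕ) (X T : ℕ → ℝ → ℝ) (t x : ℝ) (k l : ℕ) : ℝ :=
  (if k = 0 then iteratedDeriv l (T 0) t else 0) +
    (if l = 0 then iteratedDeriv k (X 0) x else 0) +
    ∑ s ∈ Finset.Icc 1 (N - 2), iteratedDeriv k (X s) x * iteratedDeriv l (T s) t

theorem det_mul_eq_zero_of_card_lt {K m n : Type*} [Field K] [Fintype m] [DecidableEq m]
    [Fintype n] (h : Fintype.card n < Fintype.card m) (A : Matrix m n K) (B : Matrix n m K) :
    (A * B).det = 0 := by
  by_contra hne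
  have rank_eq := Matrix.rank_of_isUnit _ ((Matrix.isUnit_iff_isUnit_det _).mpr (Ne.isUnit hne))
  have rank_le := (Matrix.rank_mul_le_left A B).trans A.rank_le_card_width
  omega

variable {N : ℕ} {I J : Set ℝ} {X T : ℕ → ℝ → ℝ} {u : ℝ → ℝ → ℝ} {t x : ℝ}

theorem det_alpha_self (hN : 2 ≤ N) (X T : ℕ → ℝ → ℝ) (t x : ℝ) : (alpha N X T N t x).det = 0 := by
  obtain ⟨m, rfl⟩ := Nat.exists_eq_add_of_le' hN
  have factorization : alpha (m + 2) X T (m + 2) t x =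
      (Matrix.of fun (i : Fin (m + 1)) (s : Fin m) => iteratedDeriv (i + 1) (X (s + 1)) x) *
        Matrix.of fun (s : Fin m) (j : Fin (m + 1)) => iteratedDeriv (j + 1) (T (s + 1)) t := by
    ext i j
    simp only [alpha, Matrix.of_apply, Nat.add_sub_cancel, sum_Icc_one_eq_sum_fin,
      Matrix.mul_apply]
  rw [factorization]
  exact det_mul_eq_zero_of_card_lt (by simp) _ _

theorem SmoothData.smoothOn₂_of_isSeparatedSum (hN : 2 ≤ N) (h : SmoothData N I J X T)
    (hu : IsSeparatedSum N I J X T u) : SmoothOn₂ I J u := by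
  refine SmoothOn₂.congr (u := fun t x => X 0 x + T 0 t +
    ∑ s ∈ Finset.Icc 1 (N - 2), X s x * T s t) ?_ hu
  refine ContDiffOn.add (ContDiffOn.add ?_ ?_) (ContDiffOn.sum fun s hs => ?_)
  · exact (h 0 hN).2.comp contDiffOn_snd fun _ hp => hp.2
  · exact (h 0 hN).1.comp contDiffOn_fst fun _ hp => hp.1
  · have smooth := h s (by rw [Finset.mem_Icc] at hs; omega)
    exact smoothOn₂_mul smooth.2 smooth.1

theorem SmoothData.derivSeqAt_betaEntry_left (hN : 2 ≤ N) (hI : IsOpen I)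
    (h : SmoothData N I J X T) (ht : t ∈ I) : DerivSeqAt (fun τ => betaEntry N X T τ x 0) t := by
  intro l
  have hasDerivAt_sum := HasDerivAt.fun_sum (u := Finset.Icc 1 (N - 2)) fun s hs =>
    (hasDerivAt_iteratedDeriv ((h s (by rw [Finset.mem_Icc] at hs; omega)).1.contDiffAt
      (hI.mem_nhds ht)) l).const_mul (iteratedDeriv 0 (X s) x)
  simpa [betaEntry] using! ((hasDerivAt_iteratedDeriv ((h 0 hN).1.contDiffAt
    (hI.mem_nhds ht)) l).add_const
    (if l = 0 then iteratedDeriv 0 (X 0) x else 0)).fun_add hasDerivAt_sum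

theorem SmoothData.derivSeqAt_betaEntry_right (hN : 2 ≤ N) (hJ : IsOpen J)
    (h : SmoothData N I J X T) (hx : x ∈ J) (l : ℕ) :
    DerivSeqAt (fun ξ k => betaEntry N X T t ξ k l) x := by
  intro k
  have hasDerivAt_ite : HasDerivAt (fun ξ => if l = 0 then iteratedDeriv k (X 0) ξ else 0)
      (if l = 0 then iteratedDeriv (k + 1) (X 0) x else 0) x := by
    split_ifs
    · exact hasDerivAt_iteratedDeriv ((h 0 hN).2.contDiffAt (hJ.mem_nhds hx)) k
    · exact hasDerivAt_const x 0
  have hasDerivAt_sum := HasDerivAt.fun_sum (u := Finset.Icc 1 (N - 2)) fun s hs =>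
    (hasDerivAt_iteratedDeriv ((h s (by rw [Finset.mem_Icc] at hs; omega)).2.contDiffAt
      (hJ.mem_nhds hx)) k).mul_const (iteratedDeriv l (T s) t)
  simpa [betaEntry] using! (hasDerivAt_ite.const_add
    (if k = 0 then iteratedDeriv l (T 0) t else 0)).fun_add hasDerivAt_sum

theorem SmoothData.jet_eq_betaEntry (hN : 2 ≤ N) (hI : IsOpen I) (hJ : IsOpen J)
    (h : SmoothData N I J X T) (hu : IsSeparatedSum N I J X T u) (ht : t ∈ I) (hx : x ∈ J)
    (k l : ℕ) : jet u t x k l = betaEntry N X T t x k l :=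
  jet_eq hI hJ (fun t ht x hx => by simp [betaEntry, hu t ht x hx, add_comm (X 0 x)])
    (fun _ ht _ _ => h.derivSeqAt_betaEntry_left hN hI ht)
    (fun _ _ _ hx => h.derivSeqAt_betaEntry_right hN hJ hx) ht hx k l

theorem SmoothData.det_beta (hN : 2 ≤ N) (hI : IsOpen I) (hJ : IsOpen J)
    (h : SmoothData N I J X T) (hu : IsSeparatedSum N I J X T u) (ht : t ∈ I) (hx : x ∈ J)
    (n : ℕ) : (beta N X T n t x).det = minor (jet u t x) 0 0 n :=
  congrArg Matrix.det <| Matrix.ext fun i j => (h.jet_eq_betaEntry hN hI hJ hu ht hx i j).symm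

theorem SmoothData.det_alpha_succ (hN : 2 ≤ N) (hI : IsOpen I) (hJ : IsOpen J)
    (h : SmoothData N I J X T) (hu : IsSeparatedSum N I J X T u) (ht : t ∈ I) (hx : x ∈ J)
    (n : ℕ) : (alpha N X T (n + 1) t x).det = minor (jet u t x) 1 1 n :=
  congrArg Matrix.det <| Matrix.ext fun i j => by
    simp [alpha, h.jet_eq_betaEntry hN hI hJ hu ht hx, betaEntry]

theorem SmoothData.minor_one_one_eq_zero (hN : 2 ≤ N) (hI : IsOpen I) (hJ : IsOpen J)
    (h : SmoothData N I J X T) (hu : IsSeparatedSum N I J X T u) :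
    ∀ t ∈ I, ∀ x ∈ J, minor (jet u t x) 1 1 (N - 1) = 0 := fun t ht x hx => by
  rw [← h.det_alpha_succ hN hI hJ hu ht hx, Nat.sub_add_cancel (by omega), det_alpha_self hN]

theorem SmoothData.w_partialX_partialT_eq_zero (hN : 2 ≤ N) (hI : IsOpen I) (hJ : IsOpen J)
    (h : SmoothData N I J X T) (hu : IsSeparatedSum N I J X T u) :
    ∀ t ∈ I, ∀ x ∈ J, w (N - 1) (partialX (partialT u)) t x = 0 := fun t ht x hx =>
  ((h.smoothOn₂_of_isSeparatedSum hN hu).w_partialX_partialT hI hJ ht hx _).trans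
    (h.minor_one_one_eq_zero hN hI hJ hu t ht x hx)

variable {v : ℕ → ℝ → ℝ → ℝ} {a : ℝ}

theorem SmoothData.isGivenBy_iff_isMinorRatio (hN : 2 ≤ N) (hI : IsOpen I) (hJ : IsOpen J)
    (h : SmoothData N I J X T) (hu : IsSeparatedSum N I J X T u)
    (hleft : ∀ t ∈ I, ∀ x ∈ J, v 0 t x = a) :
    IsGivenBy N a I J X T v ↔ IsMinorRatio N a I J u v := by
  constructor
  · intro hg n hn t ht x hx
    cases n with
    | zero => simp [minorRatio, numerator, hleft t ht x hx]
    | succ n =>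
      rw [minorRatio, numerator, ← h.det_beta hN hI hJ hu ht hx,
        ← h.det_alpha_succ hN hI hJ hu ht hx]
      exact hg (n + 1) (by omega) hn t ht x hx
  · intro hr n hn hnN t ht x hx
    obtain ⟨n, rfl⟩ := Nat.exists_eq_add_of_le' hn
    rw [h.det_beta hN hI hJ hu ht hx, h.det_alpha_succ hN hI hJ hu ht hx]
    exact hr (n + 1) hnN t ht x hx

theorem SmoothData.isSolution_and_generic (hN : 2 ≤ N) (hI : IsOpen I) (hJ : IsOpen J)
    (h : SmoothData N I J X T) (hv : Admissible N a I J v) (hg : IsGivenBy N a I J X T v) :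
    IsSolution N a I J v ∧ Generic N I J v := by
  let u : ℝ → ℝ → ℝ := fun t x => X 0 x + T 0 t + ∑ s ∈ Finset.Icc 1 (N - 2), X s x * T s t
  have hsep : IsSeparatedSum N I J X T u := fun _ _ _ _ => rfl
  have hu := h.smoothOn₂_of_isSeparatedSum hN hsep
  have hr := (h.isGivenBy_iff_isMinorRatio hN hI hJ hsep hv.left).mp hg
  exact ⟨hr.isSolution hI hJ hu hv (h.minor_one_one_eq_zero hN hI hJ hsep),
    hr.generic hI hJ hu hv.ne⟩

theorem IsSolution.exists_isGivenBy (hN : 2 ≤ N) (hIo : IsOpen I) (hI : I.OrdConnected)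
    (hJo : IsOpen J) (hJ : J.OrdConnected) (hv : IsSolution N a I J v) (hg : Generic N I J v) :
    ∃ X T : ℕ → ℝ → ℝ, SmoothData N I J X T ∧ IsGivenBy N a I J X T v := by
  have hu := hv.smoothOn₂_inv (by omega)
  have hr := hv.isMinorRatio hIo hJo hg
  obtain ⟨m, rfl⟩ := Nat.exists_eq_add_of_le' hN
  have w_succ_eq_zero : ∀ t ∈ I, ∀ x ∈ J, w (m + 1) _ t x = 0 := fun t ht x hx => by
    rw [hu.w_partialX_partialT hIo hJo ht hx, ← (hr.latticeEq_iff hIo hJo hu (by omega) ht hx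
      (hv.ne m (by omega) t ht x hx) (hv.ne (m + 1) (by omega) t ht x hx)).mp
      (hv.eqn (m + 1) (by omega) le_rfl t ht x hx), hv.right t ht x hx, sub_self, zero_mul]
  have w_ne_zero : ∀ t ∈ I, ∀ x ∈ J, w m _ t x ≠ 0 := fun t ht x hx => by
    rw [hu.w_partialX_partialT hIo hJo ht hx]
    refine (hr.sub_mul_minor (n := m + 1) (by omega) ht hx).symm.trans_ne (mul_ne_zero ?_
      (hr (m + 1) (by omega) t ht x hx).1)
    rw [← hv.right t ht x hx]
    exact sub_ne_zero.mpr (hv.ne (m + 1) (by omega) t ht x hx)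
  obtain ⟨X, T, hXT, hsep⟩ := hu.exists_isSeparatedSum hN hIo hI hJo hJ w_succ_eq_zero w_ne_zero
  exact ⟨X, T, hXT, (hXT.isGivenBy_iff_isMinorRatio hN hIo hJo hsep hv.left).mpr hr⟩

end SeparatedSum

end FSY

theorem mainTheorem6 (N : ℕ) (hN : 2 ≤ N) (a : ℝ) (I J : Set ℝ)
    (hIo : IsOpen I) (hI : I.OrdConnected) (hJo : IsOpen J) (hJ : J.OrdConnected) :
    -- every choice of the functions `X_s`, `T_s` gives a solution
    (∀ X T : ℕ → ℝ → ℝ, FSY.SmoothData N I J X T →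
      -- the formula for `n = N` has numerator zero, in accordance with `v_N = a`
      (∀ t ∈ I, ∀ x ∈ J, (FSY.alpha N X T N t x).det = 0) ∧
      ∀ v : ℕ → ℝ → ℝ → ℝ, FSY.Admissible N a I J v → FSY.IsGivenBy N a I J X T v →
        FSY.IsSolution N a I J v ∧ FSY.Generic N I J v) ∧
    -- every generic solution arises in this way
    (∀ v : ℕ → ℝ → ℝ → ℝ, FSY.IsSolution N a I J v → FSY.Generic N I J v →
      ∃ X T : ℕ → ℝ → ℝ, FSY.SmoothData N I J X T ∧ FSY.IsGivenBy N a I J X T v) ∧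
    -- the general solution of `w_{N-1}(u_{tx}) = 0`
    (∀ u : ℝ → ℝ → ℝ, FSY.SmoothOn₂ I J u →
      (∀ X T : ℕ → ℝ → ℝ, FSY.SmoothData N I J X T → FSY.IsSeparatedSum N I J X T u →
        ∀ t ∈ I, ∀ x ∈ J, FSY.w (N - 1) (FSY.partialX (FSY.partialT u)) t x = 0) ∧
      ((∀ t ∈ I, ∀ x ∈ J, FSY.w (N - 1) (FSY.partialX (FSY.partialT u)) t x = 0) →
        (∀ t ∈ I, ∀ x ∈ J, FSY.w (N - 2) (FSY.partialX (FSY.partialT u)) t x ≠ 0) →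
        ∃ X T : ℕ → ℝ → ℝ, FSY.SmoothData N I J X T ∧ FSY.IsSeparatedSum N I J X T u)) := by
  refine ⟨fun X T h => ⟨fun t _ x _ => FSY.det_alpha_self hN X T t x, fun v hv hg =>
      h.isSolution_and_generic hN hIo hJo hv hg⟩,
    fun v hv hg => hv.exists_isGivenBy hN hIo hI hJo hJ hg,
    fun u hu => ⟨fun X T h hsep => h.w_partialX_partialT_eq_zero hN hIo hJo hsep,
      fun hzero hne => hu.exists_isSeparatedSum hN hIo hI hJo hJ hzero hne⟩⟩
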